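/- Let $n,m,T,q\in\mathbb N$, let $A_0\in\mathbb R^{n\times n}$, $B_0\in\mathbb R^{n\times m}$, let $Q\in\mathbb R^{n\times n}$ be positive semidefinite and $R\in\mathbb R^{m\times m}$ positive definite, let $\varepsilon>0$, and let $W\in\mathbb R^{nT\times q}$ be a matrix whose columns are disturbance signals $(x_0,w_0,\dots,w_{T-2})$ (for $q=1$, a single signal). Put $\mathcal Q=I_T\otimes Q$, $\mathcal R=I_T\otimes R$, $\mathcal A_0=\mathrm{blkdiag}(A_0,\dots,A_0,0)$ and $\mathcal B_0=\mathrm{blkdiag}(B_0,\dots,B_0,0)$ with $T$ diagonal blocks, and let $\mathcal Z$ be the block-downshift operator. The random system realization is a random strictly block-lower-triangular matrix $\bar\Delta\in\mathbb R^{nT\times nT}$ ($T\times T$ blocks of size $n\times n$), of arbitrary law $\mathbb P$ that does not depend on the decision variables. For block-lower-triangular $\Phi_x\in\mathbb R^{nT\times nT}$ and $\Phi_u\in\mathbb R^{mT\times nT}$ let $$\Psi(\Phi,\bar\Delta)=\begin{bmatrix} I-\mathcal Z\mathcal A_0 & -\mathcal Z\mathcal B_0\end{bmatrix}\begin{bmatrix}\Phi_x\\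 \Phi_u\end{bmatrix}(I+\bar\Delta)-I ,$$ and let $\Lambda_{i,j}(\Phi,\bar\Delta)$ be its block in block row $i$ and block column $j$. Let $$J(\Phi)=\left\|\begin{bmatrix}\mathcal Q^{1/2}&0\\0&\mathcal R^{1/2}\end{bmatrix}\begin{bmatrix}\Phi_x\\\Phi_u\end{bmatrix}W\right\|_F^2 .$$ Let $C(\Phi,\bar\Delta)$ denote the uncertain constraint that all components of $\Lambda_{i,j}(\Phi,\bar\Delta)$, for all $i\ge j$, are at most $2\varepsilon/\sqrt{n^2T^2}$. (The result is claimed for this constraint, and also for the one that bounds the absolute values of these components by the same number; one of the two is used throughout.) Given independent samples $\bar\Delta^1,\dots,\bar\Delta^N$ of $\bar\Delta$, the scenario program is $$\min_{\Phi_x,\Phi_u,\alpha}\ \alpha\quad\text{subject to}\quad J(\Phi)\le\alpha,\qquad C(\Phi,\bar\Delta^k)\ \text{ for } k=1,\dots,N .$$ The chance-constrained program of level $p$ has the same variables and objective and the constraints $J(\Phi)\le\alpha$ and $\mathbb P\{C(\Phi,\bar\Delta)\}\ge p$. Let $\epsilon,\beta\in(0,1)$ and $$N^\star_{SC}=\frac{2}{1-\epsilon}\Big(\log\frac1\beta+n(m+n)T^2\Big).$$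 Assume that for every integer $N\ge N^\star_{SC}$ the scenario program is, for almost every sample, feasible with a unique optimal solution. Then, for every integer $N\ge N^\star_{SC}$, with probability at least $1-\beta$ over the $N$ samples, the scenario program has a unique optimal solution $(\Phi_x^{\star SC},\Phi_u^{\star SC},\alpha^\star)$, and this solution is feasible for the chance-constrained program of level $\epsilon$. In particular, if $1-\lambda/\varepsilon^2\le\epsilon$, where $\lambda=\mathbb E\,\|\mathrm{vec}\,\bar\Delta-\mathbb E\,\mathrm{vec}\,\bar\Delta\|^2$, then with probability at least $1-\beta$ it is feasible for the chance-constrained program of level $1-\lambda/\varepsilon^2$. -/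

import Mathlib

open MeasureTheory
open scoped Kronecker MatrixOrder

/-- Real block matrices with `T × T` blocks, each block of size `p × r`; the entry at
`(i, a) (j, b)` is the entry `(a, b)` of the block in block row `i` and block column `j`. -/
abbrev BlockMat (T p r : ℕ) := Matrix (Fin T × Fin p) (Fin T × Fin r) ℝ

namespace SLS

/-- Linear causal operators over the horizon: block lower triangular matrices. -/
def Causal {T p r : ℕ} (M : BlockMat T p r) : Prop :=
  ∀ i j : Fin T, i < j → ∀ a b, M (i, a) (j, b) = 0

/-- Strictly block lower triangular matrices. -/
def StrictlyCausal {T p r : ℕ} (M : BlockMat T p r) : Prop :=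
  ∀ i j : Fin T, i ≤ j → ∀ a b, M (i, a) (j, b) = 0

/-- The block-downshift operator: identities on the first block subdiagonal, zeros elsewhere. -/
def blockShift (T p : ℕ) : BlockMat T p p :=
  fun x y => if x.1.val = y.1.val + 1 ∧ x.2 = y.2 then 1 else 0

/-- `blkdiag (A, …, A, 0)` with `T` diagonal blocks. -/
def blkdiagZero (T : ℕ) {p r : ℕ} (A : Matrix (Fin p) (Fin r) ℝ) : BlockMat T p r :=
  (Matrix.diagonal fun t : Fin T => if t.val + 1 < T then (1 : ℝ) else 0) ⊗ₖ A

/-- The square of the Frobenius norm. -/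
def frobSq {ι κ : Type*} [Fintype ι] [Fintype κ] (M : Matrix ι κ ℝ) : ℝ :=
  ∑ i, ∑ j, M i j ^ 2

/-- The deterministic data: the nominal dynamics `A₀`, `B₀`, the weights `Q`, `R`, the matrix `W`
whose columns are the disturbance signals `(x₀, w₀, …, w_{T-2})` used in the cost (`q = 1` is a
single signal), and the accuracy `acc` of the chance constraint. -/
structure Data (n m T q : ℕ) where
  A₀ : Matrix (Fin n) (Fin n) ℝ
  B₀ : Matrix (Fin n) (Fin m) ℝ
  Q : Matrix (Fin n) (Fin n) ℝ
  R : Matrix (Fin m) (Fin m) ℝ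
  W : Matrix (Fin T × Fin n) (Fin q) ℝ
  acc : ℝ

/-- The decision variables of the epigraph form: the two system responses and the scalar `α`. -/
structure Decision (n m T : ℕ) where
  Φx : BlockMat T n n
  Φu : BlockMat T m n
  α : ℝ

/-- How a bound on a matrix is read: `upper` is the componentwise inequality `E ≤ c`, and
`absolute` is the componentwise inequality `|E| ≤ c`. -/
inductive Sense
  | upper
  | absolute

/-- The bound `e ≤ c` or `|e| ≤ c` on one component. -/
def Sense.Le : Sense → ℝ → ℝ → Prop
  | .upper, e, c => e ≤ c
  | .absolute, e, c => |e| ≤ c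

variable {n m T q : ℕ}

/-- `‖ diag(𝒬^{1/2}, ℛ^{1/2}) [Φx; Φu] W ‖_F²` with `𝒬 = I_T ⊗ Q` and `ℛ = I_T ⊗ R`. -/
noncomputable def cost (S : Data n m T q) (z : Decision n m T) : ℝ :=
  frobSq (Matrix.fromBlocks
      (CFC.sqrt ((1 : Matrix (Fin T) (Fin T) ℝ) ⊗ₖ S.Q)) 0
      0 (CFC.sqrt ((1 : Matrix (Fin T) (Fin T) ℝ) ⊗ₖ S.R))
    * Matrix.fromRows z.Φx z.Φu * S.W)

/-- `Υ(Φ) = [I - 𝒵𝒜₀, -𝒵ℬ₀] [Φx; Φu]`. -/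
def Upsilon (S : Data n m T q) (z : Decision n m T) : BlockMat T n n :=
  Matrix.fromCols (1 - blockShift T n * blkdiagZero T S.A₀)
      (-(blockShift T n * blkdiagZero T S.B₀))
    * Matrix.fromRows z.Φx z.Φu

/-- `Ω(Δ) = I + Δ`. -/
def Omega (D : BlockMat T n n) : BlockMat T n n := 1 + D

/-- `Ψ = Υ(Φ) Ω(Δ) - I`. -/
def Psi (S : Data n m T q) (z : Decision n m T) (D : BlockMat T n n) : BlockMat T n n :=
  Upsilon S z * Omega D - 1

/-- The block of `Ψ` in block row `i` and block column `j`. -/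
def Lam (S : Data n m T q) (z : Decision n m T) (D : BlockMat T n n) (i j : Fin T) :
    Matrix (Fin n) (Fin n) ℝ :=
  fun a b => Psi S z D (i, a) (j, b)

/-- The uncertain constraint at the realization `D`: all components of the blocks with `i ≥ j`
are bounded by `2 acc / √(n² T²)`. -/
def UncertainConstraint (S : Data n m T q) (s : Sense) (z : Decision n m T)
    (D : BlockMat T n n) : Prop :=
  ∀ i j : Fin T, j ≤ i → ∀ a b,
    s.Le (Lam S z D i j a b) (2 * S.acc / Real.sqrt ((n : ℝ) ^ 2 * (T : ℝ) ^ 2))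

/-- The constraints that do not involve the uncertainty: causality of the system responses and
the epigraph constraint. -/
def CertainConstraint (S : Data n m T q) (z : Decision n m T) : Prop :=
  Causal z.Φx ∧ Causal z.Φu ∧ cost S z ≤ z.α

/-- Feasibility for the scenario program with the sampled realizations `D 0, …, D (N-1)`. -/
def ScenarioFeasible (S : Data n m T q) (s : Sense) {N : ℕ} (D : Fin N → BlockMat T n n)
    (z : Decision n m T) : Prop :=
  CertainConstraint S z ∧ ∀ k, UncertainConstraint S s z (D k)

/-- Optimality for the scenario program: minimize `α` over the feasible decisions. -/
def ScenarioOptimal (S : Data n m T q) (s : Sense) {N : ℕ} (D : Fin N → BlockMat T n n)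
    (z : Decision n m T) : Prop :=
  ScenarioFeasible S s D z ∧ ∀ z', ScenarioFeasible S s D z' → z.α ≤ z'.α

/-- `z` is the unique optimal solution of the scenario program. -/
def UniqueScenarioOptimal (S : Data n m T q) (s : Sense) {N : ℕ} (D : Fin N → BlockMat T n n)
    (z : Decision n m T) : Prop :=
  ScenarioOptimal S s D z ∧ ∀ z', ScenarioOptimal S s D z' → z' = z

section Probability

variable {Ω : Type*} [MeasurableSpace Ω]

/-- Feasibility for the chance-constrained program in which the uncertain constraint has to hold
with probability at least `p`. -/
def ChanceFeasible (S : Data n m T q) (s : Sense) (P : Measure Ω) (Δ : Ω → BlockMat T n n)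
    (p : ℝ) (z : Decision n m T) : Prop :=
  CertainConstraint S z ∧ p ≤ P.real {ω | UncertainConstraint S s z (Δ ω)}

/-- The variance `E ‖vec Δ - E vec Δ‖²` of the vectorized random matrix `Δ`. -/
noncomputable def lam (P : Measure Ω) (Δ : Ω → BlockMat T n n) : ℝ :=
  ∫ ω, ∑ x, ∑ y, (Δ ω x y - ∫ ω', Δ ω' x y ∂P) ^ 2 ∂P

end Probability

/-- The sample size `(2 / (1 - ϵ)) (log (1 / β) + n (m + n) T²)`. -/
noncomputable def sampleBound (n m T : ℕ) (ϵ β : ℝ) : ℝ :=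
  2 / (1 - ϵ) * (Real.log (1 / β) + (n : ℝ) * ((m : ℝ) + (n : ℝ)) * (T : ℝ) ^ 2)

end SLS

/-!
The scenario bound rests on a random subsample argument. Write `p = ϵ` for the required probability
and `d = n (m + n) T²` for the number of entries of the stacked responses `[Φx; Φu]`. The cost and
the constraints are convex in these entries, so Helly's theorem (`Scenario.IsLexMin.exists_support`)
shows that the optimality of the solution for `N` samples is enforced by a set `K` of at most `d` of
them. Hence for every `M ⊇ K` the solution for the samples in `M` is the same, and if it is not
feasible for the chance constraint, then each of the `N - |M|` remaining samples lies in a set of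
probability less than `p` that does not depend on them: an event of probability at most
`p ^ (N - |M|)` (`Scenario.measure_lucky_le`). A uniformly random `M ⊆ {1, …, N}` contains `K` with
probability at least `2 ^ (-d)`, so the probability that the solution is not feasible for the chance
constraint is at most `2 ^ d * ((1 + p) / 2) ^ N` (`Scenario.two_pow_mul_measure_bad_le`). The
sample size makes this at most `2 ^ d * exp (-d) * β ≤ β`.

Two points need care. Programs with fewer samples may have several optimal solutions, or none;
therefore optimal solutions are compared by their norm as well. The set of points that are better
in this lexicographic order is still convex, and minimizers are unique. Secondly, Fubini's theorem
needs the subsample events to be measurable; they are injective images of Borel sets, the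
uniqueness of the minimizer giving injectivity (`Scenario.measurableSet_lucky`).
-/

/-! ### Lexicographic minimizers -/

namespace Scenario

section Lex

variable {E : Type*} [NormedAddCommGroup E] [InnerProductSpace ℝ E] {f : E → ℝ}

/-- `y` precedes `x` in the lexicographic order by the cost `f` and then by the norm. -/
def Better (f : E → ℝ) (y x : E) : Prop :=
  f y < f x ∨ (f y ≤ f x ∧ ‖y‖ < ‖x‖)

/-- `x` minimizes the cost `f` over `F`, ties being broken by the norm. -/
def IsLexMin (f : E → ℝ) (F : Set E) (x : E) : Prop :=
  x ∈ F ∧ ∀ y ∈ F, ¬ Better f y x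

theorem convex_better (hf : ConvexOn ℝ Set.univ f) (x : E) : Convex ℝ {y | Better f y x} := by
  intro y hy z hz a b ha hb hab
  simp only [Set.mem_ofPred_eq, Better] at hy hz ⊢
  have hfc := hf.2 (Set.mem_univ y) (Set.mem_univ z) ha hb hab
  simp only [smul_eq_mul] at hfc
  have hn : ‖a • y + b • z‖ ≤ a * ‖y‖ + b * ‖z‖ := by
    refine (norm_add_le _ _).trans_eq ?_
    rw [norm_smul, norm_smul, Real.norm_of_nonneg ha, Real.norm_of_nonneg hb]
  obtain rfl | ha' := ha.eq_or_lt
  · obtain rfl : b = 1 := by linarith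
    simpa using hz
  obtain rfl | hb' := hb.eq_or_lt
  · obtain rfl : a = 1 := by linarith
    simpa using hy
  obtain rfl : b = 1 - a := by linarith
  rcases hy with hy | ⟨hy, hy'⟩
  · have hz : f z ≤ f x := hz.elim le_of_lt And.left
    left
    nlinarith
  rcases hz with hz | ⟨hz, hz'⟩
  · left
    nlinarith
  · right
    constructor <;> nlinarith

theorem IsLexMin.unique (hf : ConvexOn ℝ Set.univ f) {F : Set E} (hF : Convex ℝ F) {x y : E}
    (hx : IsLexMin f F x) (hy : IsLexMin f F y) : x = y := by
  by_contra hne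
  have h1 := hx.2 y hy.1
  have h2 := hy.2 x hx.1
  simp only [Better, not_or, not_and, not_lt] at h1 h2
  have hfe : f x = f y := le_antisymm h1.1 h2.1
  have hne' : ‖x‖ = ‖y‖ := le_antisymm (h1.2 hfe.ge) (h2.2 hfe.le)
  have ha : (0 : ℝ) < 1 / 2 := by norm_num
  have hab : (1 / 2 : ℝ) + 1 / 2 = 1 := by norm_num
  refine hx.2 _ (hF hx.1 hy.1 ha.le ha.le hab) (Or.inr ⟨?_, ?_⟩)
  · have := hf.2 (Set.mem_univ x) (Set.mem_univ y) ha.le ha.le hab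
    simp only [smul_eq_mul] at this
    linarith
  · exact norm_combo_lt_of_ne le_rfl hne'.ge hne ha ha hab

/-- The optimality of a lexicographic minimizer is already enforced by `dim E` of the constraints:
this is Helly's theorem for the constraint sets together with the set of better points, a family
with empty intersection in which the constraint sets alone have a common point. -/
theorem IsLexMin.exists_support [FiniteDimensional ℝ E] {ι : Type*} [Fintype ι]
    (hf : ConvexOn ℝ Set.univ f) {X : Set E} (hX : Convex ℝ X) {C : ι → Set E}
    (hC : ∀ i, Convex ℝ (C i)) {x : E} (hx : IsLexMin f {y | y ∈ X ∧ ∀ i, y ∈ C i} x) :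
    ∃ K : Finset ι, K.card ≤ Module.finrank ℝ E ∧
      ∀ y ∈ X, (∀ i ∈ K, y ∈ C i) → ¬ Better f y x := by
  classical
  by_contra! hcon
  let F : Option ι → Set E := fun o => o.elim (X ∩ {y | Better f y x}) C
  have key : (⋂ o ∈ (Finset.univ : Finset (Option ι)), F o).Nonempty := by
    refine Convex.helly_theorem' (𝕜 := ℝ) ?_ ?_
    · rintro (_ | i) -
      · exact hX.inter (convex_better hf x)
      · exact hC i
    · intro I _ hI
      by_cases hnone : none ∈ I
      · obtain ⟨y, hyX, hyK, hyb⟩ := hcon (Finset.eraseNone I) (by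
          rw [Finset.card_eraseNone_of_mem hnone]
          omega)
        refine ⟨y, Set.mem_iInter₂.2 ?_⟩
        rintro (_ | i) hi
        · exact ⟨hyX, hyb⟩
        · exact hyK i (Finset.mem_eraseNone.2 hi)
      · refine ⟨x, Set.mem_iInter₂.2 ?_⟩
        rintro (_ | i) hi
        · exact absurd hi hnone
        · exact hx.1.2 i
  obtain ⟨y, hy⟩ := key
  simp only [Finset.mem_univ, Set.iInter_true, Set.mem_iInter] at hy
  exact hx.2 y ⟨(hy none).1, fun i => hy (some i)⟩ (hy none).2

end Lex

/-! ### Measurability of the minimizer and generalization to fresh samples -/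

section Bound

variable {𝓓 E : Type*} {X : Set E} {C : 𝓓 → Set E}

/-- The points of `X` that satisfy the sampled constraints `C (D i)`. -/
def feasible (X : Set E) (C : 𝓓 → Set E) {ι : Type*} (D : ι → 𝓓) : Set E :=
  {y | y ∈ X ∧ ∀ i, y ∈ C (D i)}

theorem convex_feasible [AddCommGroup E] [Module ℝ E] (hX : Convex ℝ X)
    (hC : ∀ d, Convex ℝ (C d)) {ι : Type*} (D : ι → 𝓓) :
    Convex ℝ (feasible X C D) := by
  intro y hy z hz a b ha hb hab
  exact ⟨hX hy.1 hz.1 ha hb hab, fun i => hC _ (hy.2 i) (hz.2 i) ha hb hab⟩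

theorem isClosed_feasible [TopologicalSpace 𝓓] [TopologicalSpace E] (hX : IsClosed X)
    (hC : IsClosed {p : 𝓓 × E | p.2 ∈ C p.1})
    (ι : Type*) : IsClosed {p : (ι → 𝓓) × E | p.2 ∈ feasible X C p.1} := by
  have h : {p : (ι → 𝓓) × E | p.2 ∈ feasible X C p.1} =
      {p | p.2 ∈ X} ∩ ⋂ i, {p | (p.1 i, p.2) ∈ {p : 𝓓 × E | p.2 ∈ C p.1}} := by
    ext p
    simp [feasible]
  rw [h]
  exact (hX.preimage continuous_snd).inter
    (isClosed_iInter fun i => hC.preimage (by fun_prop))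

theorem isSigmaCompact_of_isOpen {Y : Type*} [PseudoEMetricSpace Y] [SigmaCompactSpace Y]
    {U : Set Y} (hU : IsOpen U) : IsSigmaCompact U := by
  obtain ⟨F, hF, -, rfl, -⟩ := hU.exists_iUnion_isClosed
  exact isSigmaCompact_iUnion _ fun n =>
    isSigmaCompact_univ.of_isClosed_subset (hF n) (Set.subset_univ _)

theorem isSigmaCompact_inter_of_isClosed {Y : Type*} [TopologicalSpace Y] {s t : Set Y}
    (hs : IsSigmaCompact s) (ht : IsClosed t) : IsSigmaCompact (s ∩ t) := by
  obtain ⟨K, hK, rfl⟩ := hs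
  rw [Set.iUnion_inter]
  exact isSigmaCompact_iUnion_of_isCompact _ fun n => (hK n).inter_right ht

theorem measurableSet_of_isSigmaCompact {Y : Type*} [TopologicalSpace Y] [T2Space Y]
    [MeasurableSpace Y] [BorelSpace Y] {s : Set Y} (hs : IsSigmaCompact s) : MeasurableSet s := by
  obtain ⟨K, hK, rfl⟩ := hs
  exact MeasurableSet.iUnion fun n => (hK n).measurableSet

variable [MetricSpace 𝓓] [ProperSpace 𝓓] [MeasurableSpace 𝓓] [BorelSpace 𝓓]
  [NormedAddCommGroup E] [InnerProductSpace ℝ E] [FiniteDimensional ℝ E]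
  [MeasurableSpace E] [BorelSpace E] {f : E → ℝ}

/-- The pairs of a sample and its lexicographic minimizer form a Borel set: the feasible points
that are beaten are a projection of a `σ`-compact set, hence `σ`-compact. -/
theorem measurableSet_isLexMin (hf : Continuous f) (hX : IsClosed X)
    (hC : IsClosed {p : 𝓓 × E | p.2 ∈ C p.1}) (ι : Type*) [Fintype ι] :
    MeasurableSet {p : (ι → 𝓓) × E | IsLexMin f (feasible X C p.1) p.2} := by
  have hcl := isClosed_feasible hX hC ι
  let B : Set (((ι → 𝓓) × E) × E) := {p | Better f p.2 p.1.2}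
  have hB : IsSigmaCompact B := by
    have h : B = {p | f p.2 < f p.1.2} ∪ ({p | ‖p.2‖ < ‖p.1.2‖} ∩ {p | f p.2 ≤ f p.1.2}) := by
      ext p
      simp only [B, Better, Set.mem_ofPred_eq, Set.mem_union, Set.mem_inter_iff]
      tauto
    rw [h, Set.union_eq_iUnion]
    refine isSigmaCompact_iUnion _ fun b => ?_
    cases b
    · exact isSigmaCompact_inter_of_isClosed
        (isSigmaCompact_of_isOpen (isOpen_lt (by fun_prop) (by fun_prop)))
        (isClosed_le (by fun_prop) (by fun_prop))
    · exact isSigmaCompact_of_isOpen (isOpen_lt (by fun_prop) (by fun_prop))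
  have hBF := (isSigmaCompact_inter_of_isClosed hB
    (hcl.preimage (f := fun p : ((ι → 𝓓) × E) × E => (p.1.1, p.2)) (by fun_prop))).image
    continuous_fst
  have h : {p : (ι → 𝓓) × E | IsLexMin f (feasible X C p.1) p.2} =
      {p : (ι → 𝓓) × E | p.2 ∈ feasible X C p.1} \
        (Prod.fst '' (B ∩ (fun p : ((ι → 𝓓) × E) × E => (p.1.1, p.2)) ⁻¹'
          {p : (ι → 𝓓) × E | p.2 ∈ feasible X C p.1})) := by
    ext ⟨D, x⟩
    simp only [IsLexMin, B, Set.mem_ofPred_eq, Set.mem_sdiff, Set.mem_image, Set.mem_inter_iff,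
      Set.mem_preimage, Prod.exists, exists_and_right, exists_eq_right, not_exists, not_and]
    exact and_congr_right fun _ => ⟨fun h y hb hy => h y hy hb, fun h y hy hb => h y hb hy⟩
  rw [h]
  exact hcl.measurableSet.diff (measurableSet_of_isSigmaCompact hBF)

variable (X C f) in
/-- The samples `(a, b)` for which the lexicographic minimizer for `a` violates the constraint
with probability more than `1 - p`, yet satisfies all the constraints sampled in `b`. -/
def lucky (μ : Measure 𝓓) (p : ENNReal) (ι κ : Type*) : Set ((ι → 𝓓) × (κ → 𝓓)) :=
  {ab | ∃ x, IsLexMin f (feasible X C ab.1) x ∧ μ {d | x ∈ C d} < p ∧ ∀ k, x ∈ C (ab.2 k)}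

/-- By uniqueness of the minimizer, `lucky` is an injective image of a Borel set; the
Lusin–Souslin theorem applies. -/
theorem measurableSet_lucky (hfc : ConvexOn ℝ Set.univ f) (hf : Continuous f)
    (hXc : Convex ℝ X) (hX : IsClosed X) (hCc : ∀ d, Convex ℝ (C d))
    (hC : IsClosed {p : 𝓓 × E | p.2 ∈ C p.1}) (μ : Measure 𝓓) [IsProbabilityMeasure μ]
    (p : ENNReal) (ι κ : Type*) [Fintype ι] [Fintype κ] :
    MeasurableSet (lucky X C f μ p ι κ) := by
  let G : Set (((ι → 𝓓) × (κ → 𝓓)) × E) :=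
    {t | IsLexMin f (feasible X C t.1.1) t.2} ∩
      ({t | μ {d | t.2 ∈ C d} < p} ∩ {t | ∀ k, t.2 ∈ C (t.1.2 k)})
  have hG : MeasurableSet G := by
    refine MeasurableSet.inter ?_ (MeasurableSet.inter ?_ ?_)
    · exact (measurableSet_isLexMin hf hX hC ι).preimage
        (f := fun t : ((ι → 𝓓) × (κ → 𝓓)) × E => (t.1.1, t.2)) (by fun_prop)
    · have hm : Measurable fun x : E => μ {d | x ∈ C d} :=
        measurable_measure_prodMk_left (ν := μ) (s := {q : E × 𝓓 | q.1 ∈ C q.2})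
          (hC.measurableSet.preimage (f := fun q : E × 𝓓 => (q.2, q.1)) (by fun_prop))
      exact measurableSet_lt (hm.comp measurable_snd) measurable_const
    · rw [Set.ofPred_forall]
      exact MeasurableSet.iInter fun k => hC.measurableSet.preimage
        (f := fun t : ((ι → 𝓓) × (κ → 𝓓)) × E => (t.1.2 k, t.2)) (by fun_prop)
  have h : lucky X C f μ p ι κ = Prod.fst '' G := by
    ext ab
    simp [lucky, G]
  rw [h]
  refine hG.image_of_measurable_injOn measurable_fst ?_
  rintro ⟨ab, x⟩ hx ⟨ab', y⟩ hy rfl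
  exact congrArg _ (hx.1.unique hfc (convex_feasible hXc hCc _) hy.1)

theorem measure_lucky_le (hfc : ConvexOn ℝ Set.univ f) (hf : Continuous f)
    (hXc : Convex ℝ X) (hX : IsClosed X) (hCc : ∀ d, Convex ℝ (C d))
    (hC : IsClosed {p : 𝓓 × E | p.2 ∈ C p.1}) (μ : Measure 𝓓) [IsProbabilityMeasure μ]
    (p : ENNReal) (ι κ : Type*) [Fintype ι] [Fintype κ] :
    ((Measure.pi fun _ : ι => μ).prod (Measure.pi fun _ : κ => μ)) (lucky X C f μ p ι κ) ≤
      p ^ Fintype.card κ := by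
  rw [Measure.prod_apply (measurableSet_lucky hfc hf hXc hX hCc hC μ p ι κ)]
  refine (lintegral_mono (g := fun _ => p ^ Fintype.card κ) fun a => ?_).trans (by simp)
  by_cases hx : ∃ x, IsLexMin f (feasible X C a) x ∧ μ {d | x ∈ C d} < p
  · obtain ⟨x, hx, hp⟩ := hx
    have hsub : Prod.mk a ⁻¹' lucky X C f μ p ι κ ⊆ Set.univ.pi fun _ : κ => {d | x ∈ C d} := by
      rintro b ⟨y, hy, -, hb⟩ k -
      rw [hx.unique hfc (convex_feasible hXc hCc _) hy]
      exact hb k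
    refine (measure_mono hsub).trans ?_
    rw [Measure.pi_pi, Finset.prod_const, Finset.card_univ]
    exact pow_le_pow_left' hp.le _
  · have : Prod.mk a ⁻¹' lucky X C f μ p ι κ = ∅ := by
      ext b
      simp only [lucky, Set.mem_preimage, Set.mem_ofPred_eq, Set.mem_empty_iff_false, iff_false]
      rintro ⟨x, h1, h2, -⟩
      exact hx ⟨x, h1, h2⟩
    simp [this]

theorem measure_preimage_lucky_le (hfc : ConvexOn ℝ Set.univ f) (hf : Continuous f)
    (hXc : Convex ℝ X) (hX : IsClosed X) (hCc : ∀ d, Convex ℝ (C d))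
    (hC : IsClosed {p : 𝓓 × E | p.2 ∈ C p.1}) (μ : Measure 𝓓) [IsProbabilityMeasure μ]
    (p : ENNReal) {ι : Type*} [Fintype ι] (r : ι → Prop) [DecidablePred r] :
    (Measure.pi fun _ : ι => μ) (MeasurableEquiv.piEquivPiSubtypeProd (fun _ : ι => 𝓓) r ⁻¹'
      lucky X C f μ p {i // r i} {i // ¬ r i}) ≤ p ^ Fintype.card {i // ¬ r i} := by
  rw [(measurePreserving_piEquivPiSubtypeProd (fun _ : ι => μ) r).measure_preimage
    (measurableSet_lucky hfc hf hXc hX hCc hC μ p _ _).nullMeasurableSet]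
  exact measure_lucky_le hfc hf hXc hX hCc hC μ p _ _

/-! ### The violation bound by random subsamples -/

/-- The violation bound for convex scenario programs. A bad sample of size `N` with support `K` is
`lucky` for the split of the sample along any `M ⊇ K`, and at least `2 ^ (N - dim E)` of the
`2 ^ N` subsets `M` contain `K`; the measures of the `lucky` events sum to `(1 + p) ^ N`. -/
theorem two_pow_mul_measure_bad_le (hfc : ConvexOn ℝ Set.univ f) (hf : Continuous f)
    (hXc : Convex ℝ X) (hX : IsClosed X) (hCc : ∀ d, Convex ℝ (C d))
    (hC : IsClosed {p : 𝓓 × E | p.2 ∈ C p.1}) (μ : Measure 𝓓) [IsProbabilityMeasure μ]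
    (p : ENNReal) (N : ℕ) :
    2 ^ N * (Measure.pi fun _ : Fin N => μ)
        {D | ∃ x, IsLexMin f (feasible X C D) x ∧ μ {d | x ∈ C d} < p} ≤
      2 ^ Module.finrank ℝ E * (1 + p) ^ N := by
  classical
  let k := Module.finrank ℝ E
  let ν := Measure.pi fun _ : Fin N => μ
  let e (M : Finset (Fin N)) := MeasurableEquiv.piEquivPiSubtypeProd (fun _ : Fin N => 𝓓) (· ∈ M)
  let A (M : Finset (Fin N)) : Set (Fin N → 𝓓) :=
    e M ⁻¹' lucky X C f μ p {i // i ∈ M} {i // i ∉ M}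
  have hAm (M) : MeasurableSet (A M) :=
    (e M).measurable (measurableSet_lucky hfc hf hXc hX hCc hC μ p _ _)
  have hA (M) : ν (A M) ≤ p ^ (N - M.card) := by
    refine (measure_preimage_lucky_le hfc hf hXc hX hCc hC μ p (· ∈ M)).trans_eq ?_
    congr 1
    simp [Fintype.card_subtype_compl]
  have hbad (D : Fin N → 𝓓)
      (hD : D ∈ {D | ∃ x, IsLexMin f (feasible X C D) x ∧ μ {d | x ∈ C d} < p}) :
      (2 : ENNReal) ^ N ≤ 2 ^ k * ∑ M : Finset (Fin N), (A M).indicator 1 D := by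
    obtain ⟨x, hx, hp⟩ := hD
    obtain ⟨K, hKk, hK⟩ := IsLexMin.exists_support hfc hXc (fun i => hCc (D i)) hx
    have hKN : K.card ≤ N := by simpa using K.card_le_univ
    have hmem : ∀ M ∈ Finset.Icc K Finset.univ,
        (A M).indicator (1 : (Fin N → 𝓓) → ENNReal) D = 1 := by
      intro M hM
      refine Set.indicator_of_mem (s := A M) ?_ 1
      refine ⟨x, ⟨⟨hx.1.1, fun i => hx.1.2 i⟩, fun y hy => ?_⟩, hp, fun i => hx.1.2 i⟩
      exact hK y hy.1 fun i hi => hy.2 ⟨i, (Finset.mem_Icc.1 hM).1 hi⟩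
    calc (2 : ENNReal) ^ N = 2 ^ K.card * 2 ^ (N - K.card) := by
          rw [← pow_add, Nat.add_sub_cancel' hKN]
      _ ≤ 2 ^ k * 2 ^ (N - K.card) := by
          gcongr
          exact one_le_two
      _ = 2 ^ k * ∑ M ∈ Finset.Icc K Finset.univ, (A M).indicator 1 D := by
          rw [Finset.sum_congr rfl hmem, Finset.sum_const,
            Finset.card_Icc_finset (Finset.subset_univ K)]
          simp
      _ ≤ 2 ^ k * ∑ M : Finset (Fin N), (A M).indicator 1 D := by
          gcongr
          exact Finset.subset_univ _
  have hmeas : Measurable fun D =>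
      2 ^ k * ∑ M : Finset (Fin N), (A M).indicator (1 : (Fin N → 𝓓) → ENNReal) D :=
    Measurable.const_mul (Finset.measurable_fun_sum _ fun M _ => measurable_one.indicator (hAm M)) _
  -- Markov's inequality for the number of `M` with a lucky split; the superlevel set is measurable,
  -- whereas nothing is known about the bad event itself.
  calc 2 ^ N * ν {D | ∃ x, IsLexMin f (feasible X C D) x ∧ μ {d | x ∈ C d} < p}
      ≤ 2 ^ N * ν {D | (2 : ENNReal) ^ N ≤
          2 ^ k * ∑ M : Finset (Fin N), (A M).indicator 1 D} := by
        gcongr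
        exact hbad _
    _ ≤ ∫⁻ D, 2 ^ k * ∑ M : Finset (Fin N), (A M).indicator 1 D ∂ν :=
        mul_meas_ge_le_lintegral hmeas _
    _ = 2 ^ k * ∑ M : Finset (Fin N), ν (A M) := by
        rw [lintegral_const_mul _
          (Finset.measurable_fun_sum _ fun M _ => measurable_one.indicator (hAm M)),
          lintegral_finsetSum _ fun M _ => measurable_one.indicator (hAm M)]
        simp only [lintegral_indicator_one (hAm _)]
    _ ≤ 2 ^ k * ∑ M : Finset (Fin N), 1 ^ M.card * p ^ (N - M.card) := by
        gcongr with M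
        rw [one_pow, one_mul]
        exact hA M
    _ = 2 ^ k * (1 + p) ^ N := by
        rw [Fin.sum_pow_mul_eq_add_pow]

end Bound

end Scenario

namespace SLS

/-! ### System level synthesis as a convex scenario program -/

section Program

variable {n m T q : ℕ}

/-- The space of the stacked system responses `[Φx; Φu]`, all entries being free; its dimension is
`n (m + n) T²`. Causality is imposed as a constraint. -/
abbrev Responses (n m T : ℕ) :=
  EuclideanSpace ℝ (((Fin T × Fin n) ⊕ (Fin T × Fin m)) × (Fin T × Fin n))

theorem finrank_responses (n m T : ℕ) :
    Module.finrank ℝ (Responses n m T) = n * (m + n) * T ^ 2 := by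
  simp only [finrank_euclideanSpace, Fintype.card_prod, Fintype.card_sum, Fintype.card_fin]
  ring

/-- The matrix `[Φx; Φu]`. -/
def stack (x : Responses n m T) : Matrix ((Fin T × Fin n) ⊕ (Fin T × Fin m)) (Fin T × Fin n) ℝ :=
  Matrix.of fun i j => x (i, j)

/-- The decision with system responses `x` and epigraph variable `α`. -/
def decisionOf (x : Responses n m T) (α : ℝ) : Decision n m T :=
  ⟨(stack x).toRows₁, (stack x).toRows₂, α⟩

/-- The system responses of a decision. -/
def responsesOf (z : Decision n m T) : Responses n m T :=
  WithLp.toLp 2 fun p => Matrix.fromRows z.Φx z.Φu p.1 p.2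

theorem responsesOf_decisionOf (x : Responses n m T) (α : ℝ) :
    responsesOf (decisionOf x α) = x := by
  ext p
  simp [responsesOf, decisionOf, stack]

theorem stack_combo (a b : ℝ) (x y : Responses n m T) :
    stack (a • x + b • y) = a • stack x + b • stack y := rfl

theorem continuous_stack : Continuous (stack : Responses n m T → _) :=
  continuous_matrix fun i j => by
    simp only [stack, Matrix.of_apply]
    fun_prop

/-- The cost as a function of the system responses. -/
noncomputable def responseCost (S : Data n m T q) (x : Responses n m T) : ℝ :=
  cost S (decisionOf x 0)

theorem responseCost_eq (S : Data n m T q) (x : Responses n m T) :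
    responseCost S x = frobSq (Matrix.fromBlocks
      (CFC.sqrt ((1 : Matrix (Fin T) (Fin T) ℝ) ⊗ₖ S.Q)) 0
      0 (CFC.sqrt ((1 : Matrix (Fin T) (Fin T) ℝ) ⊗ₖ S.R)) * stack x * S.W) := by
  simp only [responseCost, cost, decisionOf, Matrix.fromRows_toRows]

theorem continuous_responseCost (S : Data n m T q) : Continuous (responseCost S) := by
  simp only [funext (responseCost_eq S), frobSq]
  refine continuous_finsetSum _ fun i _ => continuous_finsetSum _ fun j _ => ?_
  exact (((continuous_const.matrix_mul continuous_stack).matrix_mul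
    continuous_const).matrix_elem i j).pow 2

theorem convexOn_responseCost (S : Data n m T q) :
    ConvexOn ℝ Set.univ (responseCost S) := by
  refine ⟨convex_univ, fun x _ y _ a b ha hb hab => ?_⟩
  simp only [responseCost_eq, frobSq, stack_combo, Matrix.mul_add, Matrix.add_mul,
    Matrix.mul_smul, Matrix.smul_mul, Matrix.add_apply, Matrix.smul_apply]
  simp only [Finset.smul_sum, ← Finset.sum_add_distrib]
  exact Finset.sum_le_sum fun i _ => Finset.sum_le_sum fun j _ =>
    (even_two.convexOn_pow (𝕜 := ℝ)).2 (Set.mem_univ _) (Set.mem_univ _) ha hb hab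

/-- The causal system responses. -/
def causalResponses (n m T : ℕ) : Set (Responses n m T) :=
  {x | Causal (decisionOf x 0).Φx ∧ Causal (decisionOf x 0).Φu}

theorem convex_causalResponses : Convex ℝ (causalResponses n m T) := by
  rintro x ⟨hx, hx'⟩ y ⟨hy, hy'⟩ a b - - -
  simp only [causalResponses, Causal, decisionOf, Matrix.toRows₁_apply, Matrix.toRows₂_apply,
    Set.mem_ofPred_eq, stack_combo, Matrix.add_apply, Matrix.smul_apply] at *
  constructor <;> intros <;> simp [*]

theorem isClosed_causalResponses : IsClosed (causalResponses n m T) := by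
  simp only [causalResponses, Causal, decisionOf, Matrix.toRows₁_apply, Matrix.toRows₂_apply,
    Set.ofPred_and, Set.ofPred_forall]
  refine IsClosed.inter ?_ ?_ <;>
    exact isClosed_iInter fun _ => isClosed_iInter fun _ => isClosed_iInter fun _ =>
      isClosed_iInter fun _ => isClosed_iInter fun _ =>
        isClosed_eq (continuous_stack.matrix_elem _ _) continuous_const

/-- The system responses that satisfy the uncertain constraint at the realization `D`. -/
def robustResponses (S : Data n m T q) (s : Sense) (D : Fin T × Fin n → Fin T × Fin n → ℝ) :
    Set (Responses n m T) :=
  {x | UncertainConstraint S s (decisionOf x 0) (Matrix.of D)}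

theorem convex_setOf_le (s : Sense) (c : ℝ) : Convex ℝ {e | s.Le e c} := by
  cases s
  · exact convex_Iic c
  · simp only [Sense.Le, abs_le]
    exact convex_Icc (-c) c

theorem isClosed_setOf_le (s : Sense) (c : ℝ) : IsClosed {e | s.Le e c} := by
  cases s
  · exact isClosed_Iic
  · exact isClosed_le continuous_abs continuous_const

theorem Psi_decisionOf (S : Data n m T q) (x : Responses n m T) (D : BlockMat T n n) :
    Psi S (decisionOf x 0) D = Matrix.fromCols (1 - blockShift T n * blkdiagZero T S.A₀)
      (-(blockShift T n * blkdiagZero T S.B₀)) * stack x * (1 + D) - 1 := by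
  simp only [Psi, Upsilon, Omega, decisionOf, Matrix.fromRows_toRows]

theorem Psi_combo (S : Data n m T q) (x y : Responses n m T) (D : BlockMat T n n) {a b : ℝ}
    (hab : a + b = 1) : Psi S (decisionOf (a • x + b • y) 0) D =
      a • Psi S (decisionOf x 0) D + b • Psi S (decisionOf y 0) D := by
  obtain rfl : b = 1 - a := by linarith
  simp only [Psi_decisionOf, stack_combo]
  rw [Matrix.mul_add _ (a • _), Matrix.add_mul, Matrix.mul_smul, Matrix.mul_smul, Matrix.smul_mul,
    Matrix.smul_mul]
  module

theorem convex_robustResponses (S : Data n m T q) (s : Sense)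
    (D : Fin T × Fin n → Fin T × Fin n → ℝ) : Convex ℝ (robustResponses S s D) := by
  intro x hx y hy a b ha hb hab i j hij k l
  simp only [Lam, Psi_combo S x y _ hab]
  exact convex_setOf_le s _ (hx i j hij k l) (hy i j hij k l) ha hb hab

theorem isClosed_robustResponses (S : Data n m T q) (s : Sense) :
    IsClosed {p : (Fin T × Fin n → Fin T × Fin n → ℝ) × Responses n m T |
      p.2 ∈ robustResponses S s p.1} := by
  simp only [robustResponses, UncertainConstraint, Set.mem_ofPred_eq, Lam]
  simp only [Set.ofPred_forall]
  have h1 : Continuous fun p : (Fin T × Fin n → Fin T × Fin n → ℝ) × Responses n m T =>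
      stack p.2 := continuous_stack.comp continuous_snd
  have h2 : Continuous fun p : (Fin T × Fin n → Fin T × Fin n → ℝ) × Responses n m T =>
      (1 + Matrix.of p.1 : BlockMat T n n) :=
    continuous_const.add (continuous_matrix fun i j => by
      simp only [Matrix.of_apply]
      fun_prop)
  have h3 : Continuous fun p : (Fin T × Fin n → Fin T × Fin n → ℝ) × Responses n m T =>
      Psi S (decisionOf p.2 0) (Matrix.of p.1) := by
    simp only [Psi_decisionOf]
    exact ((continuous_const.matrix_mul h1).matrix_mul h2).sub continuous_const
  exact isClosed_iInter fun i => isClosed_iInter fun j => isClosed_iInter fun _ =>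
    isClosed_iInter fun a => isClosed_iInter fun b =>
      (isClosed_setOf_le s _).preimage (h3.matrix_elem (i, a) (j, b))

/-- A unique optimal solution of the scenario program is a lexicographic minimizer: a feasible
point of at most the same cost is optimal too, hence the same point. -/
theorem UniqueScenarioOptimal.isLexMin {S : Data n m T q} {s : Sense} {N : ℕ}
    {D : Fin N → BlockMat T n n} {z : Decision n m T} (hz : UniqueScenarioOptimal S s D z) :
    Scenario.IsLexMin (responseCost S) (Scenario.feasible (causalResponses n m T)
      (robustResponses S s) fun k i j => D k i j) (responsesOf z) := by
  have hfeas : ∀ y ∈ Scenario.feasible (causalResponses n m T) (robustResponses S s)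
      (fun k i j => D k i j), ScenarioFeasible S s D (decisionOf y (responseCost S y)) :=
    fun y hy => ⟨⟨hy.1.1, hy.1.2, le_rfl⟩, hy.2⟩
  have hmem : responsesOf z ∈ Scenario.feasible (causalResponses n m T) (robustResponses S s)
      (fun k i j => D k i j) := ⟨⟨hz.1.1.1.1, hz.1.1.1.2.1⟩, hz.1.1.2⟩
  have hα : responseCost S (responsesOf z) ≤ z.α := hz.1.1.1.2.2
  refine ⟨hmem, fun y hy => ?_⟩
  have hle : z.α ≤ responseCost S y := hz.1.2 _ (hfeas y hy)
  rintro (h | ⟨h, hnorm⟩)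
  · linarith
  · have hopt : ScenarioOptimal S s D (decisionOf y (responseCost S y)) :=
      ⟨hfeas y hy, fun z' hz' => (h.trans hα).trans (hz.1.2 z' hz')⟩
    have hy' : y = responsesOf z := by rw [← hz.2 _ hopt, responsesOf_decisionOf]
    exact absurd hnorm (by rw [hy']; exact lt_irrefl _)

end Program

/-! ### The sample size and the guarantee -/

/-- The sample size makes the violation bound at most `β`, by `(1 + ϵ) / 2 ≤ exp (-(1 - ϵ) / 2)`
and `2 ≤ exp 1`. -/
theorem two_pow_mul_le_of_sampleBound_le {n m T N : ℕ} {ϵ β : ℝ} (hϵ : 0 < ϵ ∧ ϵ < 1)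
    (hβ : 0 < β) (hN : sampleBound n m T ϵ β ≤ N) :
    2 ^ (n * (m + n) * T ^ 2) * (1 + ϵ) ^ N ≤ 2 ^ N * β := by
  have h1ϵ : 0 < 1 - ϵ := by linarith [hϵ.2]
  have hN' : Real.log (1 / β) + ((n * (m + n) * T ^ 2 : ℕ) : ℝ) ≤ (1 - ϵ) / 2 * N := by
    have h := mul_le_mul_of_nonneg_left hN (half_pos h1ϵ).le
    rw [sampleBound] at h
    push_cast
    refine le_of_eq_of_le ?_ h
    field_simp
  set k := n * (m + n) * T ^ 2
  have h2 : (2 : ℝ) ^ k ≤ Real.exp k := by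
    rw [← mul_one (k : ℝ), Real.exp_nat_mul]
    gcongr
    linarith [Real.add_one_le_exp (1 : ℝ)]
  have h3 : (1 + ϵ) ^ N ≤ 2 ^ N * Real.exp (-((1 - ϵ) / 2 * N)) := by
    have : 1 + ϵ ≤ 2 * Real.exp (-((1 - ϵ) / 2)) := by
      linarith [Real.add_one_le_exp (-((1 - ϵ) / 2))]
    calc (1 + ϵ) ^ N ≤ (2 * Real.exp (-((1 - ϵ) / 2))) ^ N := by
          gcongr
          linarith [hϵ.1]
      _ = _ := by
          rw [mul_pow, ← Real.exp_nat_mul]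
          ring_nf
  have h4 : Real.exp k * Real.exp (-((1 - ϵ) / 2 * N)) ≤ β := by
    rw [← Real.exp_add, ← Real.le_log_iff_exp_le hβ]
    rw [one_div, Real.log_inv] at hN'
    linarith
  have h1ϵ' : 0 ≤ 1 + ϵ := by linarith [hϵ.1]
  calc 2 ^ k * (1 + ϵ) ^ N
      ≤ Real.exp k * (2 ^ N * Real.exp (-((1 - ϵ) / 2 * N))) := by gcongr
    _ = 2 ^ N * (Real.exp k * Real.exp (-((1 - ϵ) / 2 * N))) := by ring
    _ ≤ 2 ^ N * β := by gcongr

theorem ChanceFeasible.mono {n m T q : ℕ} {Ω : Type*} [MeasurableSpace Ω] {P : Measure Ω}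
    {Δ : Ω → BlockMat T n n} {S : Data n m T q} {s : Sense} {p p' : ℝ} {z : Decision n m T}
    (h : ChanceFeasible S s P Δ p z) (hp : p' ≤ p) : ChanceFeasible S s P Δ p' z :=
  ⟨h.1, hp.trans h.2⟩

/-- The guarantee for one sample size `N`. Only the scenario program with `N` samples is assumed to
have a unique optimal solution almost surely; programs with fewer samples need no such assumption,
since their role is played by lexicographic minimizers. The event need not be measurable, so it is
bounded through the image of the samples under `Δ`, where Borel sets are available. -/
theorem measure_not_chanceFeasible_le {n m T q : ℕ} {Ω : Type*} [MeasurableSpace Ω]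
    (P : Measure Ω) [IsProbabilityMeasure P]
    (Δ : Ω → BlockMat T n n) (hΔ : ∀ x y, Measurable fun ω => Δ ω x y)
    (S : Data n m T q) (s : Sense) {ϵ β : ℝ} (hϵ : 0 < ϵ ∧ ϵ < 1) (hβ : 0 < β)
    {N : ℕ} (hN : sampleBound n m T ϵ β ≤ N)
    (hunique : ∀ᵐ ω ∂Measure.pi (fun _ : Fin N => P),
      ∃ z, UniqueScenarioOptimal S s (fun k => Δ (ω k)) z) :
    Measure.pi (fun _ : Fin N => P)
      {ω | ¬ ∃ z, UniqueScenarioOptimal S s (fun k => Δ (ω k)) z ∧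
        ChanceFeasible S s P Δ ϵ z} ≤ ENNReal.ofReal β := by
  let D (ω : Ω) : Fin T × Fin n → Fin T × Fin n → ℝ := fun x y => Δ ω x y
  have hD : Measurable D := measurable_pi_lambda _ fun x => measurable_pi_lambda _ fun y => hΔ x y
  let μ := P.map D
  have : IsProbabilityMeasure μ := Measure.isProbabilityMeasure_map hD.aemeasurable
  let bad : Set (Fin N → Fin T × Fin n → Fin T × Fin n → ℝ) :=
    {d | ∃ x, Scenario.IsLexMin (responseCost S) (Scenario.feasible (causalResponses n m T)
      (robustResponses S s) d) x ∧ μ {d | x ∈ robustResponses S s d} < ENNReal.ofReal ϵ}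
  have hbad : 2 ^ N * Measure.pi (fun _ : Fin N => μ) bad ≤ _ :=
    Scenario.two_pow_mul_measure_bad_le (convexOn_responseCost S) (continuous_responseCost S)
      convex_causalResponses isClosed_causalResponses (convex_robustResponses S s)
      (isClosed_robustResponses S s) μ (ENNReal.ofReal ϵ) N
  have hle : Measure.pi (fun _ : Fin N => μ) bad ≤ ENNReal.ofReal β := by
    rw [finrank_responses] at hbad
    have h2 : (2 : ENNReal) ^ N ≠ 0 := by simp
    have h2' : (2 : ENNReal) ^ N ≠ ⊤ := by simp
    rw [← ENNReal.mul_le_mul_iff_right h2 h2']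
    refine hbad.trans ?_
    have h := ENNReal.ofReal_le_ofReal (two_pow_mul_le_of_sampleBound_le hϵ hβ hN)
    have hϵ' : 0 ≤ 1 + ϵ := by linarith [hϵ.1]
    rw [ENNReal.ofReal_mul (by positivity), ENNReal.ofReal_mul (by positivity),
      ENNReal.ofReal_pow zero_le_two, ENNReal.ofReal_pow zero_le_two,
      ENNReal.ofReal_pow hϵ', ENNReal.ofReal_add zero_le_one hϵ.1.le] at h
    simpa using h
  have hmp : MeasurePreserving (fun (ω : Fin N → Ω) k => D (ω k))
      (Measure.pi fun _ => P) (Measure.pi fun _ => μ) :=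
    measurePreserving_pi _ _ fun _ => hD.measurePreserving P
  refine le_trans (le_trans (measure_mono_ae ?_)
    (Measure.le_map_apply hmp.measurable.aemeasurable bad)) (hmp.map_eq.symm ▸ hle)
  filter_upwards [hunique] with ω ⟨z, hz⟩ hω
  refine ⟨responsesOf z, hz.isLexMin, ?_⟩
  by_contra! hge
  refine hω ⟨z, hz, hz.1.1.1, ?_⟩
  have hms : MeasurableSet {d | responsesOf z ∈ robustResponses S s d} :=
    ((isClosed_robustResponses S s).preimage
      (f := fun d => (d, responsesOf z)) (by fun_prop)).measurableSet
  rw [Measure.map_apply hD hms] at hge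
  exact (ENNReal.ofReal_le_iff_le_toReal (measure_ne_top _ _)).1 hge

end SLS

theorem theorem5 {n m T q : ℕ} {Ω : Type*} [MeasurableSpace Ω]
    (P : Measure Ω) [IsProbabilityMeasure P]
    (Δ : Ω → BlockMat T n n) (hΔ_meas : ∀ x y, Measurable fun ω => Δ ω x y)
    (hΔ_causal : ∀ᵐ ω ∂P, SLS.StrictlyCausal (Δ ω))
    (S : SLS.Data n m T q) (hQ : S.Q.PosSemidef) (hR : S.R.PosDef) (hacc : 0 < S.acc)
    (s : SLS.Sense) (ϵ β : ℝ) (hϵ : 0 < ϵ ∧ ϵ < 1) (hβ : 0 < β ∧ β < 1)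
    (hunique : ∀ N : ℕ, SLS.sampleBound n m T ϵ β ≤ N →
      ∀ᵐ ω ∂Measure.pi (fun _ : Fin N => P),
        ∃ z, SLS.UniqueScenarioOptimal S s (fun k => Δ (ω k)) z)
    (N : ℕ) (hN : SLS.sampleBound n m T ϵ β ≤ N) :
    Measure.pi (fun _ : Fin N => P)
        {ω | ¬ ∃ z, SLS.UniqueScenarioOptimal S s (fun k => Δ (ω k)) z ∧
          SLS.ChanceFeasible S s P Δ ϵ z} ≤ ENNReal.ofReal β ∧
    (1 - SLS.lam P Δ / S.acc ^ 2 ≤ ϵ →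
      Measure.pi (fun _ : Fin N => P)
        {ω | ¬ ∃ z, SLS.UniqueScenarioOptimal S s (fun k => Δ (ω k)) z ∧
          SLS.ChanceFeasible S s P Δ (1 - SLS.lam P Δ / S.acc ^ 2) z} ≤ ENNReal.ofReal β) := by
  have h := SLS.measure_not_chanceFeasible_le P Δ hΔ_meas S s hϵ hβ.1 hN (hunique N hN)
  refine ⟨h, fun hlam => (measure_mono ?_).trans h⟩
  rintro ω hω ⟨z, hz, hz'⟩
  exact hω ⟨z, hz, hz'.mono hlam⟩
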